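/- Let $G$ be a discrete group. A compact $G$-space is a nonempty compact Hausdorff space on which $G$ acts by homeomorphisms. A $G$-boundary is a compact $G$-space $X$ on which the action is minimal (every orbit is dense) and strongly proximal (for every regular Borel probability measure $\nu$ on $X$, the weak* closure of the orbit $G\nu$ contains a point mass). The Furstenberg boundary $\partial_F G$ is the universal $G$-boundary, i.e. the $G$-boundary, unique up to $G$-equivariant homeomorphism, of which every $G$-boundary is a continuous $G$-equivariant image. A group $H$ is amenable if there is a unital positive linear functional on $\ell^\infty(H)$ that is invariant under left translation, and the amenable radical $R_a(G)$ is the largest amenable normal subgroup of $G$ (equivalently, the subgroup generated by all amenable normal subgroups). Then: (1) $\partial_F G = \partial_F(G/R_a(G))$ as $G$-spaces: there is a homeomorphism $\varphi:\partial_F G\to\partial_F(G/R_a(G))$ with $\varphi(gx)=(gR_a(G))\,\varphi(x)$ for all $g\in G$ and $x\in\partial_F G$. (2) If the action of $G$ on $\partial_F G$ is topologically free, i.e. for every $s\in G$ with $s\neq e$ the set $\{x\in\partial_F G : sx\neq x\}$ is dense in $\partial_F G$, then $R_a(G)$ is trivial. -/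

import Mathlib

open MeasureTheory Topology Filter
open scoped ComplexOrder ENNReal

universe u v w

/-- `X` is a compact (Hausdorff, nonempty) `G`-space, for the discrete group `G`. -/
structure IsCompactGSpace (G : Type u) (X : Type v) [Group G] [TopologicalSpace X]
    [MulAction G X] : Prop where
  nonempty : Nonempty X
  compactSpace : CompactSpace X
  t2Space : T2Space X
  continuousConstSMul : ContinuousConstSMul G X

/-- Strong proximality: for every regular Borel probability measure `ν` on `X`, the weak* closure
of the orbit `G ν` contains a point mass. The topology on `ProbabilityMeasure X` is the one of
convergence of the integrals of all bounded continuous functions, and `g ν` is the image of `ν`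
under `x ↦ g • x`. -/
def IsStronglyProximal (G : Type u) (X : Type v) [Group G] [TopologicalSpace X]
    [MulAction G X] : Prop :=
  letI : MeasurableSpace X := borel X
  have : BorelSpace X := ⟨rfl⟩
  ∀ ν : ProbabilityMeasure X, (ν : Measure X).Regular →
    ∃ x : X, diracProba x ∈ closure
      {μ : ProbabilityMeasure X | ∃ g : G, (μ : Measure X) = (ν : Measure X).map (fun y => g • y)}

/-- A `G`-boundary: a compact `G`-space with a minimal and strongly proximal action. -/
structure IsBoundary (G : Type u) (X : Type v) [Group G] [TopologicalSpace X]
    [MulAction G X] : Prop extends IsCompactGSpace G X where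
  isMinimal : MulAction.IsMinimal G X
  isStronglyProximal : IsStronglyProximal G X

/-- `X` is (a model of) the Furstenberg boundary of `G`: a `G`-boundary which is universal, in the
sense that every `G`-boundary is a continuous `G`-equivariant image of `X`. It suffices to test
this on boundaries `B` in the universe of `G`: see `IsFurstenbergBoundary.exists_map`. A model
exists, by `exists_isFurstenbergBoundary`. -/
structure IsFurstenbergBoundary (G : Type u) (X : Type v) [Group G] [TopologicalSpace X]
    [MulAction G X] : Prop extends IsBoundary G X where
  universal : ∀ (B : Type u) [TopologicalSpace B] [MulAction G B], IsBoundary G B →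
    ∃ f : X → B, Continuous f ∧ (∀ (g : G) (x : X), f (g • x) = g • f x) ∧ Function.Surjective f

/-- The action of `G` on `X` is topologically free. -/
def IsTopologicallyFree (G : Type u) (X : Type v) [Group G] [TopologicalSpace X]
    [MulAction G X] : Prop :=
  ∀ s : G, s ≠ 1 → Dense {x : X | s • x ≠ x}

/-- `G` is amenable: there is a unital positive linear map `m` from `ℓ^∞(G)` to `ℂ` which is
`G`-equivariant, i.e. invariant under left translation. -/
def IsAmenable (G : Type u) [Group G] : Prop :=
  ∃ m : lp (fun _ : G => ℂ) ∞ →ₗ[ℂ] ℂ,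
    m 1 = 1 ∧
    (∀ f : lp (fun _ : G => ℂ) ∞, (∀ s, 0 ≤ f s) → 0 ≤ m f) ∧
    (∀ (t : G) (f f' : lp (fun _ : G => ℂ) ∞), (∀ s, f' s = f (t⁻¹ * s)) → m f' = m f)

/-- The amenable radical: the subgroup generated by all amenable normal subgroups. It is the
largest amenable normal subgroup, by `isGreatest_amenableRadical`. -/
def amenableRadical (G : Type u) [Group G] : Subgroup G :=
  sSup {N : Subgroup G | N.Normal ∧ IsAmenable N}

instance amenableRadical_normal (G : Type u) [Group G] : (amenableRadical G).Normal :=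
  Subgroup.sSup_normal _ fun _ h => h.1

/-! ### Existence of the Furstenberg boundary -/

/-- A nonempty closed set that is invariant under a family of maps of a compact space contains a
minimal such set. -/
theorem exists_minimal_closed_invariant {ι : Type*} {Z : Type*} [TopologicalSpace Z]
    [CompactSpace Z] (T : ι → Z → Z) (C : Set Z) (hC : IsClosed C) (hne : C.Nonempty)
    (hT : ∀ i, ∀ z ∈ C, T i z ∈ C) :
    ∃ K ⊆ C, IsClosed K ∧ K.Nonempty ∧ (∀ i, ∀ z ∈ K, T i z ∈ K) ∧
      ∀ D ⊆ K, IsClosed D → D.Nonempty → (∀ i, ∀ z ∈ D, T i z ∈ D) → D = K := by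
  obtain ⟨K, hKC, hK⟩ := zorn_superset_nonempty
    {K : Set Z | IsClosed K ∧ K.Nonempty ∧ ∀ i, ∀ z ∈ K, T i z ∈ K} (by
      intro c hc hchain hcne
      refine ⟨⋂₀ c, ⟨isClosed_sInter fun s hs => (hc hs).1, ?_, ?_⟩,
        fun s hs => Set.sInter_subset_of_mem hs⟩
      · have : Nonempty c := hcne.to_subtype
        rw [Set.sInter_eq_iInter]
        refine IsCompact.nonempty_iInter_of_directed_nonempty_isCompact_isClosed _ ?_
          (fun s => (hc s.2).2.1) (fun s => (hc s.2).1.isCompact) (fun s => (hc s.2).1)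
        intro a b
        rcases hchain.total a.2 b.2 with h | h
        · exact ⟨a, le_rfl, h⟩
        · exact ⟨b, h, le_rfl⟩
      · intro i z hz s hs
        exact (hc hs).2.2 i z (hz s hs)) C ⟨hC, hne, hT⟩
  refine ⟨K, hKC, hK.prop.1, hK.prop.2.1, hK.prop.2.2, fun D hD h1 h2 h3 => ?_⟩
  exact hD.antisymm (hK.le_of_le ⟨h1, h2, h3⟩ hD)

theorem ProbabilityMeasure.mem_closure_of_integral_eq {X : Type*} [TopologicalSpace X]
    [MeasurableSpace X] [OpensMeasurableSpace X] (S : Set (ProbabilityMeasure X))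
    (μ μ' : ProbabilityMeasure X) (hμ : μ ∈ closure S)
    (h : ∀ f : BoundedContinuousFunction X ℝ, ∫ x, f x ∂(μ : Measure X) =
      ∫ x, f x ∂(μ' : Measure X)) : μ' ∈ closure S := by
  rw [mem_closure_iff_ultrafilter] at hμ ⊢
  obtain ⟨F, hF, hl⟩ := hμ
  refine ⟨F, hF, ?_⟩
  have h1 : Tendsto id (F : Filter _) (𝓝 μ) := hl
  rw [ProbabilityMeasure.tendsto_iff_forall_integral_tendsto] at h1
  have h2 : Tendsto id (F : Filter _) (𝓝 μ') := by
    rw [ProbabilityMeasure.tendsto_iff_forall_integral_tendsto]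
    intro f
    rw [← h f]
    exact h1 f
  exact h2

/-- Strong proximality, in terms of integrals: for every Borel probability measure. -/
theorem IsStronglyProximal.exists_ultrafilter {G : Type u} {X : Type v} [Group G]
    [TopologicalSpace X] [MulAction G X] [CompactSpace X] [T2Space X] [ContinuousConstSMul G X]
    [MeasurableSpace X] [BorelSpace X] (h : IsStronglyProximal G X) (ν : ProbabilityMeasure X) :
    ∃ (x : X) (F : Ultrafilter G), ∀ f : BoundedContinuousFunction X ℝ,
      Tendsto (fun g : G => ∫ y, f (g • y) ∂(ν : Measure X)) F (𝓝 (f x)) := by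
  have hm : ‹MeasurableSpace X› = borel X := BorelSpace.measurable_eq
  subst hm
  let _ : MeasurableSpace X := borel X
  have _ : BorelSpace X := ⟨rfl⟩
  obtain ⟨ν', hreg, hfin, hint⟩ := Measure.exists_regular_eq_of_compactSpace (ν : Measure X)
  have hp : IsProbabilityMeasure ν' := by
    have := hint (BoundedContinuousFunction.const X 1)
    simp only [BoundedContinuousFunction.const_apply, integral_const, probReal_univ, smul_eq_mul,
      mul_one] at this
    constructor
    rw [← ENNReal.toReal_eq_one_iff]
    exact this.symm
  obtain ⟨x, hx⟩ := h ⟨ν', hp⟩ hreg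
  rw [mem_closure_iff_ultrafilter] at hx
  obtain ⟨F, hF, hl⟩ := hx
  let c : G → ProbabilityMeasure X := fun g =>
    ProbabilityMeasure.map ⟨ν', hp⟩ (f := fun y => g • y)
      (continuous_const_smul g).measurable.aemeasurable
  have hr : Set.range c ∈ F := by
    refine mem_of_superset hF ?_
    rintro μ ⟨g, hg⟩
    refine ⟨g, Subtype.ext ?_⟩
    exact hg.symm
  obtain ⟨F', hF'⟩ : ∃ F' : Ultrafilter G, F'.map c = F := by
    have : (Filter.comap c F).NeBot := Filter.comap_neBot_iff.2 fun t ht => by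
      obtain ⟨_, h1, ⟨g, rfl⟩⟩ := F.nonempty_of_mem (Filter.inter_mem ht hr)
      exact ⟨g, h1⟩
    refine ⟨Ultrafilter.of (Filter.comap c F), ?_⟩
    refine Ultrafilter.coe_le_coe.1 ?_
    rw [Ultrafilter.coe_map]
    exact (Filter.map_mono (Ultrafilter.of_le _)).trans Filter.map_comap_le
  have ht : Tendsto c F' (𝓝 (diracProba x)) := by
    rw [Tendsto, ← Ultrafilter.coe_map, hF']
    exact hl
  rw [ProbabilityMeasure.tendsto_iff_forall_integral_tendsto] at ht
  refine ⟨x, F', fun f => ?_⟩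
  have h1 := ht f
  have h2 : ∫ ω, f ω ∂((diracProba x : ProbabilityMeasure X) : Measure X) = f x := by
    rw [show ((diracProba x : ProbabilityMeasure X) : Measure X) = Measure.dirac x from rfl]
    exact integral_dirac' _ _ f.continuous.stronglyMeasurable
  rw [h2] at h1
  refine h1.congr fun g => ?_
  have h3 : ∫ ω, f ω ∂(c g : Measure X) = ∫ ω, f (g • ω) ∂ν' := by
    rw [show (c g : Measure X) = ν'.map (fun y => g • y) from rfl]
    exact integral_map (continuous_const_smul g).measurable.aemeasurable
      f.continuous.measurable.aestronglyMeasurable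
  rw [h3]
  exact (hint (f.compContinuous ⟨fun y => g • y, continuous_const_smul g⟩)).symm

/-- A compact `G`-space that embeds in a product of strongly proximal ones is strongly proximal. -/
theorem isStronglyProximal_of_jointly_injective {G : Type u} {X : Type v} [Group G]
    [TopologicalSpace X] [MulAction G X] [CompactSpace X] [T2Space X] [ContinuousConstSMul G X]
    {ι : Type*} {B : ι → Type*} [∀ i, TopologicalSpace (B i)] [∀ i, MulAction G (B i)]
    [∀ i, CompactSpace (B i)] [∀ i, T2Space (B i)] [∀ i, ContinuousConstSMul G (B i)]
    (hB : ∀ i, IsStronglyProximal G (B i)) (p : ∀ i, X → B i) (hp : ∀ i, Continuous (p i))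
    (hpe : ∀ i (g : G) (x : X), p i (g • x) = g • p i x)
    (hinj : ∀ x y : X, (∀ i, p i x = p i y) → x = y) : IsStronglyProximal G X := by
  let : MeasurableSpace X := borel X
  have : BorelSpace X := ⟨rfl⟩
  let : ∀ i, MeasurableSpace (B i) := fun i => borel (B i)
  have : ∀ i, BorelSpace (B i) := fun i => ⟨rfl⟩
  change ∀ ν : ProbabilityMeasure X, (ν : Measure X).Regular →
    ∃ x : X, diracProba x ∈ closure
      {μ : ProbabilityMeasure X | ∃ g : G, (μ : Measure X) = (ν : Measure X).map (fun y => g • y)}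
  intro ν _
  let T : G → ProbabilityMeasure X → ProbabilityMeasure X := fun g μ =>
    μ.map (f := fun y => g • y) (continuous_const_smul g).measurable.aemeasurable
  have hTc : ∀ g, Continuous (T g) := fun g =>
    ProbabilityMeasure.continuous_map (continuous_const_smul g)
  have hTi : ∀ (g : G) (μ : ProbabilityMeasure X) (f : BoundedContinuousFunction X ℝ),
      ∫ x, f x ∂(T g μ : Measure X) = ∫ x, f (g • x) ∂(μ : Measure X) := by
    intro g μ f
    rw [show (T g μ : Measure X) = (μ : Measure X).map (fun y => g • y) from rfl]
    exact integral_map (continuous_const_smul g).measurable.aemeasurable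
      f.continuous.measurable.aestronglyMeasurable
  set S := {μ : ProbabilityMeasure X | ∃ g : G,
    (μ : Measure X) = (ν : Measure X).map (fun y => g • y)} with hS
  have hSinv : ∀ g, ∀ μ ∈ S, T g μ ∈ S := by
    rintro g μ ⟨k, hk⟩
    refine ⟨g * k, ?_⟩
    rw [show (T g μ : Measure X) = (μ : Measure X).map (fun y => g • y) from rfl, hk,
      Measure.map_map (continuous_const_smul g).measurable (continuous_const_smul k).measurable]
    congr 1
    funext y
    simp [mul_smul]
  obtain ⟨K, hKS, hKc, hKne, hKT, hKmin⟩ := exists_minimal_closed_invariant T (closure S)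
    isClosed_closure ⟨T 1 ν, subset_closure ⟨1, rfl⟩⟩ (fun g μ hμ =>
      map_mem_closure (hTc g) hμ (hSinv g))
  -- every member of `K` has point masses as its images in the `B i`
  have key : ∀ i, ∀ μ ∈ K, ∃ b : B i, ∀ f : BoundedContinuousFunction (B i) ℝ,
      ∫ x, f (p i x) ∂(μ : Measure X) = f b := by
    intro i
    let comp : BoundedContinuousFunction (B i) ℝ → BoundedContinuousFunction X ℝ :=
      fun f => f.compContinuous ⟨p i, hp i⟩
    let D : Set (ProbabilityMeasure X) := {μ | ∃ b : B i, ∀ f : BoundedContinuousFunction (B i) ℝ,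
      ∫ x, f (p i x) ∂(μ : Measure X) = f b}
    have hD : IsClosed D := by
      have h1 : IsClosed {q : ProbabilityMeasure X × B i |
          ∀ f : BoundedContinuousFunction (B i) ℝ, ∫ x, comp f x ∂(q.1 : Measure X) = f q.2} := by
        simp only [Set.ofPred_forall]
        refine isClosed_iInter fun f => isClosed_eq ?_ (f.continuous.comp continuous_snd)
        refine Continuous.comp (g := fun μ : ProbabilityMeasure X =>
          ∫ x, comp f x ∂(μ : Measure X)) ?_ continuous_fst
        exact continuous_iff_continuousAt.2 fun μ =>
          ProbabilityMeasure.tendsto_iff_forall_integral_tendsto.1 tendsto_id (comp f)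
      have h2 := isClosedMap_fst_of_compactSpace _ h1
      convert h2 using 1
      ext μ
      simp only [Set.mem_image, Prod.exists, exists_and_right, exists_eq_right]
      rfl
    have hDT : ∀ g, ∀ μ ∈ D, T g μ ∈ D := by
      rintro g μ ⟨b, hb⟩
      refine ⟨g • b, fun f => ?_⟩
      refine ((hTi g μ (comp f)).trans ?_).trans
        (hb (f.compContinuous ⟨fun y => g • y, continuous_const_smul g⟩))
      refine integral_congr_ae (Eventually.of_forall fun x => ?_)
      change f (p i (g • x)) = f (g • p i x)
      rw [hpe]
    have hKD : (K ∩ D).Nonempty := by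
      obtain ⟨μ, hμ⟩ := hKne
      obtain ⟨b, F, hF⟩ := (hB i).exists_ultrafilter
        (μ.map (f := p i) (hp i).measurable.aemeasurable)
      have hle : ∃ M, (F.map (fun g => T g μ) : Filter (ProbabilityMeasure X)) ≤ 𝓝 M :=
        ⟨_, (F.map (fun g => T g μ)).le_nhds_lim⟩
      obtain ⟨M, hM⟩ := hle
      have hM' : Tendsto (fun g => T g μ) F (𝓝 M) := hM
      refine ⟨M, hKc.mem_of_tendsto hM' (Eventually.of_forall fun g => hKT g μ hμ), b,
        fun f => ?_⟩
      have h1 := ProbabilityMeasure.tendsto_iff_forall_integral_tendsto.1 hM' (comp f)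
      refine tendsto_nhds_unique h1 ((hF f).congr fun g => ?_)
      rw [hTi]
      rw [show ((μ.map (f := p i) (hp i).measurable.aemeasurable : ProbabilityMeasure (B i)) :
        Measure (B i)) = (μ : Measure X).map (p i) from rfl]
      refine (integral_map (f := fun y => f (g • y)) (hp i).measurable.aemeasurable
        (f.continuous.comp (continuous_const_smul g)).measurable.aestronglyMeasurable).trans ?_
      refine integral_congr_ae (Eventually.of_forall fun x => ?_)
      change f (g • p i x) = f (p i (g • x))
      rw [hpe]
    have := hKmin (K ∩ D) Set.inter_subset_left (hKc.inter hD) hKD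
      (fun g μ hμ => ⟨hKT g μ hμ.1, hDT g μ hμ.2⟩)
    intro μ hμ
    rw [← this] at hμ
    exact hμ.2
  obtain ⟨M, hM⟩ := hKne
  choose b hb using fun i => key i M hM
  obtain ⟨M', hreg, hfin, hint⟩ := Measure.exists_regular_eq_of_compactSpace (M : Measure X)
  have huniv : M' Set.univ = 1 := by
    have := hint (BoundedContinuousFunction.const X 1)
    simp only [BoundedContinuousFunction.const_apply, integral_const, probReal_univ, smul_eq_mul,
      mul_one] at this
    rw [← ENNReal.toReal_eq_one_iff]
    exact this.symm
  -- compact sets away from a fibre are null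
  have hopen : ∀ i, IsOpen {x : X | p i x ≠ b i} := fun i =>
    isOpen_ne_fun (hp i) continuous_const
  have hnull : ∀ i, M' {x : X | p i x ≠ b i} = 0 := by
    intro i
    rw [(hopen i).measure_eq_iSup_isCompact]
    simp only [ENNReal.iSup_eq_zero]
    intro L hL hLc
    have hLi : IsCompact (p i '' L) := hLc.image (hp i)
    obtain ⟨φ, hφ0, hφ1, hφ⟩ := exists_continuous_zero_one_of_isClosed
      (s := {b i}) (t := p i '' L) isClosed_singleton hLi.isClosed (by
        rw [Set.disjoint_singleton_left]
        rintro ⟨x, hx, hxb⟩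
        exact hL hx hxb)
    let f : BoundedContinuousFunction (B i) ℝ := BoundedContinuousFunction.mkOfCompact φ
    have h0 : ∫ x, f (p i x) ∂M' = 0 := by
      refine (hint (f.compContinuous ⟨p i, hp i⟩)).symm.trans ((hb i f).trans ?_)
      exact hφ0 rfl
    have hint' : Integrable (fun x => f (p i x)) M' :=
      (f.compContinuous ⟨p i, hp i⟩).integrable M'
    have h0 := (integral_eq_zero_iff_of_nonneg (f := fun x => f (p i x))
      (fun x => (hφ (p i x)).1) hint').1 h0
    refine measure_mono_null (fun x hx => ?_) h0
    change ¬ (f (p i x) = 0)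
    have : f (p i x) = 1 := hφ1 ⟨x, hx, rfl⟩
    rw [this]
    exact one_ne_zero
  have hU : M' (⋃ i, {x : X | p i x ≠ b i}) = 0 := by
    rw [(isOpen_iUnion hopen).measure_eq_iSup_isCompact]
    simp only [ENNReal.iSup_eq_zero]
    intro L hL hLc
    obtain ⟨t, ht⟩ := hLc.elim_finite_subcover _ hopen hL
    refine measure_mono_null ht ?_
    exact (measure_biUnion_null_iff t.countable_toSet).2 fun i _ => hnull i
  obtain ⟨x, hx⟩ : ∃ x : X, ∀ i, p i x = b i := by
    by_contra hcon
    push Not at hcon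
    have : (⋃ i, {x : X | p i x ≠ b i}) = Set.univ :=
      Set.eq_univ_of_forall fun x => Set.mem_iUnion.2 (hcon x)
    rw [this, huniv] at hU
    exact one_ne_zero hU
  have hae : ∀ᵐ y ∂M', y = x := by
    refine measure_mono_null (fun y hy => ?_) hU
    by_contra hcon
    simp only [Set.mem_iUnion, Set.mem_ofPred_eq, not_exists, not_not] at hcon
    exact hy (hinj y x fun i => (hcon i).trans (hx i).symm)
  refine ⟨x, ProbabilityMeasure.mem_closure_of_integral_eq S M _ (hKS hM) fun f => ?_⟩
  rw [hint f, show ((diracProba x : ProbabilityMeasure X) : Measure X) = Measure.dirac x from rfl,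
    integral_dirac' _ _ f.continuous.stronglyMeasurable,
    integral_congr_ae (g := fun _ => f x) (hae.mono fun y hy => by simp only [hy])]
  simp [Measure.real, huniv]

/-- The set of indices for the product of all boundaries of `G`, up to isomorphism. -/
structure BoundaryIndex (G : Type u) [Group G] : Type u where
  carrier : Set (Ultrafilter G)
  top : TopologicalSpace carrier
  act : MulAction G carrier
  isBoundary : IsBoundary G carrier

/-- Every boundary is isomorphic to one that is carried by a set of ultrafilters on `G`. -/
theorem IsBoundary.exists_index {G : Type u} [Group G] {B : Type v} [TopologicalSpace B]
    [MulAction G B] (hB : IsBoundary G B) : ∃ i : BoundaryIndex G,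
      letI := i.top
      letI := i.act
      ∃ f : i.carrier ≃ₜ B, ∀ (g : G) (x : i.carrier), f (g • x) = g • f x := by
  have := hB.nonempty
  have := hB.compactSpace
  have := hB.t2Space
  have := hB.continuousConstSMul
  have := hB.isMinimal
  obtain ⟨b⟩ := hB.nonempty
  have hex : ∀ c : B, ∃ U : Ultrafilter G, Tendsto (fun g : G => g • b) U (𝓝 c) := by
    intro c
    have h1 : (Filter.comap (fun g : G => g • b) (𝓝 c)).NeBot :=
      Filter.comap_neBot_iff.2 fun t ht => by
        obtain ⟨g, hg⟩ := (denseRange_smul G b).exists_mem_open isOpen_interior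
          ⟨c, mem_interior_iff_mem_nhds.2 ht⟩
        exact ⟨g, interior_subset hg⟩
    exact ⟨Ultrafilter.of _, (Filter.map_mono (Ultrafilter.of_le _)).trans Filter.map_comap_le⟩
  choose U hU using hex
  have hinj : Function.Injective U := fun c d h =>
    tendsto_nhds_unique (hU c) (h ▸ hU d)
  let e : Set.range U ≃ B := (Equiv.ofInjective U hinj).symm
  let t : TopologicalSpace (Set.range U) := TopologicalSpace.induced e inferInstance
  let a : MulAction G (Set.range U) := e.mulAction G
  let h : Set.range U ≃ₜ B := e.toHomeomorphOfIsInducing ⟨rfl⟩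
  have he : ∀ (g : G) (x : Set.range U), h (g • x) = g • h x := fun g x =>
    e.apply_symm_apply _
  have c1 : CompactSpace (Set.range U) := h.symm.compactSpace
  have c2 : T2Space (Set.range U) := h.symm.t2Space
  have c3 : ContinuousConstSMul G (Set.range U) := ⟨fun g => by
    rw [← h.comp_continuous_iff]
    refine ((continuous_const_smul g).comp h.continuous).congr fun x => (he g x).symm⟩
  refine ⟨⟨Set.range U, t, a, ⟨⟨⟨h.symm b⟩, c1, c2, c3⟩, ⟨fun x => ?_⟩, ?_⟩⟩, h, he⟩
  · refine (h.symm.surjective.denseRange.comp (denseRange_smul G (h x))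
      h.symm.continuous).mono ?_
    rintro _ ⟨g, rfl⟩
    exact ⟨g, h.injective ((he g x).trans (h.apply_symm_apply _).symm)⟩
  · exact isStronglyProximal_of_jointly_injective (ι := Unit) (B := fun _ => B)
      (fun _ => hB.isStronglyProximal) (fun _ => h) (fun _ => h.continuous) (fun _ => he)
      (fun x y hxy => h.injective (hxy ()))

/-- Every group has a Furstenberg boundary. -/
theorem exists_isFurstenbergBoundary (G : Type u) [Group G] :
    ∃ (X : Type u) (_ : TopologicalSpace X) (_ : MulAction G X), IsFurstenbergBoundary G X := by
  let _ : ∀ i : BoundaryIndex G, TopologicalSpace i.carrier := fun i => i.top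
  let _ : ∀ i : BoundaryIndex G, MulAction G i.carrier := fun i => i.act
  have _ : ∀ i : BoundaryIndex G, CompactSpace i.carrier := fun i => i.isBoundary.compactSpace
  have _ : ∀ i : BoundaryIndex G, T2Space i.carrier := fun i => i.isBoundary.t2Space
  have _ : ∀ i : BoundaryIndex G, Nonempty i.carrier := fun i => i.isBoundary.nonempty
  have _ : ∀ i : BoundaryIndex G, ContinuousConstSMul G i.carrier :=
    fun i => i.isBoundary.continuousConstSMul
  let P : Type u := ∀ i : BoundaryIndex G, i.carrier
  obtain ⟨K, -, hKc, hKne, hKT, hKmin⟩ := exists_minimal_closed_invariant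
    (fun (g : G) (x : P) => g • x) Set.univ isClosed_univ Set.univ_nonempty
    (fun _ _ _ => Set.mem_univ _)
  let X : SubMulAction G P := ⟨K, fun g x hx => hKT g x hx⟩
  have : Nonempty X := hKne.to_subtype
  have : CompactSpace X := isCompact_iff_compactSpace.1 hKc.isCompact
  have : T2Space X := inferInstanceAs (T2Space K)
  have : ContinuousConstSMul G X := ⟨fun g => by
    refine Continuous.subtype_mk (f := fun x : X => g • (x : P)) ?_ _
    exact (continuous_const_smul g).comp continuous_subtype_val⟩
  have hmin : MulAction.IsMinimal G X := by
    refine ⟨fun x => ?_⟩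
    have h1 := hKmin (Subtype.val '' closure (MulAction.orbit G x))
      (by rintro _ ⟨y, -, rfl⟩; exact y.2)
      ((isClosed_closure.isCompact.image continuous_subtype_val).isClosed)
      (((MulAction.nonempty_orbit x).mono subset_closure).image _) (by
        rintro g _ ⟨y, hy, rfl⟩
        refine ⟨g • y, map_mem_closure (continuous_const_smul g) hy fun z hz => ?_, rfl⟩
        exact MulAction.mem_orbit_of_mem_orbit g hz)
    intro y
    obtain ⟨z, hz, hzy⟩ := h1.ge y.2
    rwa [← Subtype.ext hzy]
  have hb : IsBoundary G X := ⟨⟨inferInstance, inferInstance, inferInstance, inferInstance⟩, hmin,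
    isStronglyProximal_of_jointly_injective (fun i : BoundaryIndex G =>
      i.isBoundary.isStronglyProximal) (fun i x => x.1 i)
      (fun i => (continuous_apply i).comp continuous_subtype_val) (fun _ _ _ => rfl)
      (fun x y h => Subtype.ext (funext h))⟩
  refine ⟨X, inferInstance, inferInstance, hb, fun B _ _ hB => ?_⟩
  obtain ⟨i, f, hf⟩ := hB.exists_index
  have := hB.t2Space
  have := hB.isMinimal
  have hc : Continuous fun x : X => f (x.1 i) :=
    f.continuous.comp ((continuous_apply i).comp continuous_subtype_val)
  have he : ∀ (g : G) (x : X), f ((g • x).1 i) = g • f (x.1 i) := fun g x => hf g (x.1 i)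
  refine ⟨fun x => f (x.1 i), hc, he, ?_⟩
  rw [← Set.range_eq_univ]
  obtain ⟨x₀⟩ := ‹Nonempty X›
  refine (isCompact_range hc).isClosed.closure_eq ▸ (Dense.mono ?_
    (MulAction.dense_orbit G (f (x₀.1 i)))).closure_eq
  rintro _ ⟨g, rfl⟩
  exact ⟨g • x₀, he g x₀⟩

/-- The universal property holds for boundaries in every universe. -/
theorem IsFurstenbergBoundary.exists_map {G : Type u} [Group G] {X : Type v} [TopologicalSpace X]
    [MulAction G X] (hX : IsFurstenbergBoundary G X) (B : Type w) [TopologicalSpace B]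
    [MulAction G B] (hB : IsBoundary G B) :
    ∃ f : X → B, Continuous f ∧ (∀ (g : G) (x : X), f (g • x) = g • f x) ∧
      Function.Surjective f := by
  obtain ⟨i, f, hf⟩ := hB.exists_index
  let _ := i.top
  let _ := i.act
  obtain ⟨p, hp, hpe, hps⟩ := hX.universal i.carrier i.isBoundary
  exact ⟨f ∘ p, f.continuous.comp hp, fun g x => by simp only [Function.comp_apply, hpe, hf],
    f.surjective.comp hps⟩

/-! ### The amenable radical is amenable -/

/-- A bounded function as an element of `ℓ^∞`. -/
def boundedFun {S : Type*} (f : S → ℂ) (C : ℝ) (h : ∀ s, ‖f s‖ ≤ C) :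
    lp (fun _ : S => ℂ) ∞ :=
  ⟨f, memℓp_infty ⟨C, by rintro _ ⟨s, rfl⟩; exact h s⟩⟩

/-- Left translation on `ℓ^∞(G)`. -/
noncomputable def leftTranslate {G : Type*} [Group G] (t : G) (f : lp (fun _ : G => ℂ) ∞) :
    lp (fun _ : G => ℂ) ∞ :=
  boundedFun (fun s => f (t⁻¹ * s)) ‖f‖ fun s => lp.norm_apply_le_norm (by simp) f (t⁻¹ * s)

/-- A mean on `ℓ^∞(S)`: a unital positive linear functional. -/
structure IsMean {S : Type*} (m : lp (fun _ : S => ℂ) ∞ →ₗ[ℂ] ℂ) : Prop where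
  one : m 1 = 1
  pos : ∀ f : lp (fun _ : S => ℂ) ∞, (∀ s, 0 ≤ f s) → 0 ≤ m f

theorem IsMean.bound_real {S : Type*} {m : lp (fun _ : S => ℂ) ∞ →ₗ[ℂ] ℂ} (hm : IsMean m)
    (f : lp (fun _ : S => ℂ) ∞) (C : ℝ) (h : ∀ s, ∃ r : ℝ, f s = r ∧ |r| ≤ C) : ‖m f‖ ≤ C := by
  have h1 := hm.pos ((C : ℂ) • 1 - f) fun s => by
    obtain ⟨r, hr, hC⟩ := h s
    have : ((C : ℂ) • (1 : lp (fun _ : S => ℂ) ∞) - f) s = ((C - r : ℝ) : ℂ) := by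
      change (C : ℂ) * 1 - f s = _
      simp [hr]
    rw [this, Complex.zero_le_real]
    linarith [le_abs_self r]
  have h2 := hm.pos ((C : ℂ) • 1 + f) fun s => by
    obtain ⟨r, hr, hC⟩ := h s
    have : ((C : ℂ) • (1 : lp (fun _ : S => ℂ) ∞) + f) s = ((C + r : ℝ) : ℂ) := by
      change (C : ℂ) * 1 + f s = _
      simp [hr]
    rw [this, Complex.zero_le_real]
    linarith [neg_abs_le r]
  rw [map_sub, map_smul, hm.one, smul_eq_mul, mul_one, Complex.le_def] at h1
  rw [map_add, map_smul, hm.one, smul_eq_mul, mul_one, Complex.le_def] at h2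
  simp only [Complex.zero_re, Complex.zero_im, Complex.sub_re, Complex.sub_im, Complex.add_re,
    Complex.add_im, Complex.ofReal_re, Complex.ofReal_im] at h1 h2
  have h3 : m f = ((m f).re : ℂ) := Complex.ext rfl (by simp; linarith [h1.2])
  rw [h3, Complex.norm_real, Real.norm_eq_abs, abs_le]
  constructor <;> linarith [h1.1, h2.1]

theorem IsMean.bound {S : Type*} {m : lp (fun _ : S => ℂ) ∞ →ₗ[ℂ] ℂ} (hm : IsMean m)
    (f : lp (fun _ : S => ℂ) ∞) : ‖m f‖ ≤ 2 * ‖f‖ := by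
  have hf : ∀ s, ‖f s‖ ≤ ‖f‖ := fun s => lp.norm_apply_le_norm (by simp) f s
  let a := boundedFun (fun s => ((f s).re : ℂ)) ‖f‖ fun s => by
    rw [Complex.norm_real]; exact (Complex.abs_re_le_norm _).trans (hf s)
  let b := boundedFun (fun s => ((f s).im : ℂ)) ‖f‖ fun s => by
    rw [Complex.norm_real]; exact (Complex.abs_im_le_norm _).trans (hf s)
  have hab : f = a + Complex.I • b := by
    refine lp.ext (funext fun s => ?_)
    change f s = ((f s).re : ℂ) + Complex.I * ((f s).im : ℂ)
    rw [mul_comm, Complex.re_add_im]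
  have ha : ‖m a‖ ≤ ‖f‖ := hm.bound_real a _ fun s =>
    ⟨_, rfl, (Complex.abs_re_le_norm _).trans (hf s)⟩
  have hb : ‖m b‖ ≤ ‖f‖ := hm.bound_real b _ fun s =>
    ⟨_, rfl, (Complex.abs_im_le_norm _).trans (hf s)⟩
  calc ‖m f‖ = ‖m a + Complex.I * m b‖ := by
        conv_lhs => rw [hab, map_add, map_smul, smul_eq_mul]
    _ ≤ ‖m a‖ + ‖Complex.I * m b‖ := norm_add_le _ _
    _ ≤ 2 * ‖f‖ := by rw [norm_mul, Complex.norm_I, one_mul]; linarith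

theorem leftTranslate_mul {G : Type*} [Group G] (s t : G) (f : lp (fun _ : G => ℂ) ∞) :
    leftTranslate (s * t) f = leftTranslate s (leftTranslate t f) := by
  refine lp.ext (funext fun x => ?_)
  change f ((s * t)⁻¹ * x) = f (t⁻¹ * (s⁻¹ * x))
  rw [mul_inv_rev, mul_assoc]

theorem leftTranslate_one {G : Type*} [Group G] (f : lp (fun _ : G => ℂ) ∞) :
    leftTranslate 1 f = f := by
  refine lp.ext (funext fun x => ?_)
  change f (1⁻¹ * x) = f x
  rw [inv_one, one_mul]

theorem norm_leftTranslate_le {G : Type*} [Group G] (t : G) (f : lp (fun _ : G => ℂ) ∞) :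
    ‖leftTranslate t f‖ ≤ ‖f‖ :=
  lp.norm_le_of_forall_le (norm_nonneg _) fun s =>
    lp.norm_apply_le_norm (by simp) f (t⁻¹ * s)

theorem isAmenable_iff (G : Type u) [Group G] : IsAmenable G ↔
    ∃ m : lp (fun _ : G => ℂ) ∞ →ₗ[ℂ] ℂ, IsMean m ∧ ∀ t f, m (leftTranslate t f) = m f := by
  constructor
  · rintro ⟨m, h1, h2, h3⟩
    exact ⟨m, ⟨h1, h2⟩, fun t f => h3 t f _ fun s => rfl⟩
  · rintro ⟨m, h1, h2⟩
    refine ⟨m, h1.one, h1.pos, fun t f f' h => ?_⟩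
    rw [show f' = leftTranslate t f from lp.ext (funext h), h2]

/-- Averaging a mean over an amenable subgroup. -/
theorem exists_average {G : Type u} [Group G] (N : Subgroup G) (hN : IsAmenable N)
    (m : lp (fun _ : G => ℂ) ∞ →ₗ[ℂ] ℂ) (hm : IsMean m) :
    ∃ m' : lp (fun _ : G => ℂ) ∞ →ₗ[ℂ] ℂ, IsMean m' ∧
      (∀ t ∈ N, ∀ f, m' (leftTranslate t f) = m' f) ∧
      ∀ H : Subgroup G, H.Normal → (∀ t ∈ H, ∀ f, m (leftTranslate t f) = m f) →
        ∀ t ∈ H, ∀ f, m' (leftTranslate t f) = m' f := by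
  obtain ⟨μ, hμ, hinv⟩ := (isAmenable_iff N).1 hN
  let A : lp (fun _ : G => ℂ) ∞ →ₗ[ℂ] lp (fun _ : N => ℂ) ∞ :=
    { toFun := fun f => boundedFun (fun n : N => m (leftTranslate (n : G)⁻¹ f)) (2 * ‖f‖)
        fun n => (hm.bound _).trans (by linarith [norm_leftTranslate_le (n : G)⁻¹ f])
      map_add' := fun f g => lp.ext (funext fun n => map_add m
        (leftTranslate (n : G)⁻¹ f) (leftTranslate (n : G)⁻¹ g))
      map_smul' := fun c f => lp.ext (funext fun n => map_smul m c
        (leftTranslate (n : G)⁻¹ f)) }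
  have hA : ∀ f (n : N), A f n = m (leftTranslate (n : G)⁻¹ f) := fun f n => rfl
  refine ⟨μ ∘ₗ A, ⟨?_, ?_⟩, ?_, ?_⟩
  · have : A 1 = 1 := lp.ext (funext fun n => hm.one)
    rw [LinearMap.comp_apply, this, hμ.one]
  · intro f hf
    exact hμ.pos _ fun n => hm.pos _ fun s => hf _
  · intro t ht f
    rw [LinearMap.comp_apply, LinearMap.comp_apply, ← hinv ⟨t, ht⟩ (A f)]
    congr 1
    refine lp.ext (funext fun n => ?_)
    change m (leftTranslate (n : G)⁻¹ (leftTranslate t f)) =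
      m (leftTranslate (t⁻¹ * (n : G))⁻¹ f)
    rw [← leftTranslate_mul, mul_inv_rev, inv_inv]
  · intro H hH hmH t ht f
    rw [LinearMap.comp_apply, LinearMap.comp_apply]
    congr 1
    refine lp.ext (funext fun n => ?_)
    rw [hA, hA, ← leftTranslate_mul, show (n : G)⁻¹ * t = ((n : G)⁻¹ * t * n) * (n : G)⁻¹ by group,
      leftTranslate_mul]
    refine hmH _ ?_ _
    have := hH.conj_mem t ht (n : G)⁻¹
    rwa [inv_inv] at this

/-- An amenable subgroup, from a mean on the whole group. -/
theorem isAmenable_of_invariant_mean {G : Type u} [Group G] (R : Subgroup G)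
    (m : lp (fun _ : G => ℂ) ∞ →ₗ[ℂ] ℂ) (hm : IsMean m)
    (h : ∀ t ∈ R, ∀ f, m (leftTranslate t f) = m f) : IsAmenable R := by
  let τ : G → G := fun s => (Quotient.mk (QuotientGroup.rightRel R) s).out
  have hτ : ∀ s, s * (τ s)⁻¹ ∈ R := fun s =>
    QuotientGroup.rightRel_apply.1 (Quotient.mk_out (s := QuotientGroup.rightRel R) s)
  have hτ' : ∀ (r : R) (s : G), τ (r * s) = τ s := fun r s => by
    have : Quotient.mk (QuotientGroup.rightRel R) (r * s) =
        Quotient.mk (QuotientGroup.rightRel R) s := by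
      refine Quotient.sound (QuotientGroup.rightRel_apply.2 ?_)
      rw [mul_inv_rev, mul_inv_cancel_left]
      exact R.inv_mem r.2
    simp only [τ, this]
  let ρ : G → R := fun s => ⟨s * (τ s)⁻¹, hτ s⟩
  let E : lp (fun _ : R => ℂ) ∞ →ₗ[ℂ] lp (fun _ : G => ℂ) ∞ :=
    { toFun := fun f => boundedFun (fun s => f (ρ s)) ‖f‖
        fun s => lp.norm_apply_le_norm (by simp) f (ρ s)
      map_add' := fun f g => lp.ext (funext fun n => rfl)
      map_smul' := fun c f => lp.ext (funext fun n => rfl) }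
  refine (isAmenable_iff R).2 ⟨m ∘ₗ E, ⟨?_, fun f hf => hm.pos _ fun s => hf _⟩, fun t f => ?_⟩
  · have : E 1 = 1 := lp.ext (funext fun n => rfl)
    rw [LinearMap.comp_apply, this, hm.one]
  · rw [LinearMap.comp_apply, LinearMap.comp_apply, ← h t t.2 (E f)]
    congr 1
    refine lp.ext (funext fun s => ?_)
    change f (t⁻¹ * ρ s) = f (ρ ((t : G)⁻¹ * s))
    refine congrArg f (Subtype.ext ?_)
    change (t : G)⁻¹ * (s * (τ s)⁻¹) = (t : G)⁻¹ * s * (τ ((t : G)⁻¹ * s))⁻¹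
    have := hτ' t⁻¹ s
    rw [Subgroup.coe_inv] at this
    rw [this, mul_assoc]

/-- The amenable radical is the largest amenable normal subgroup. -/
theorem isGreatest_amenableRadical (G : Type u) [Group G] :
    IsGreatest {N : Subgroup G | N.Normal ∧ IsAmenable N} (amenableRadical G) := by
  classical
  refine ⟨⟨inferInstance, ?_⟩, fun N hN => le_sSup hN⟩
  let 𝒩 := {N : Subgroup G // N.Normal ∧ IsAmenable N}
  have hfin : ∀ F : Finset 𝒩, ∃ m : lp (fun _ : G => ℂ) ∞ →ₗ[ℂ] ℂ, IsMean m ∧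
      ∀ N ∈ F, ∀ t ∈ N.1, ∀ f, m (leftTranslate t f) = m f := by
    intro F
    induction F using Finset.induction_on with
    | empty =>
      refine ⟨{ toFun := fun f => f 1, map_add' := fun _ _ => rfl, map_smul' := fun _ _ => rfl },
        ⟨rfl, fun f hf => hf 1⟩, fun N hN => absurd hN (Finset.notMem_empty N)⟩
    | insert N F _ ih =>
      obtain ⟨m, hm, hmF⟩ := ih
      obtain ⟨m', hm', h1, h2⟩ := exists_average N.1 N.2.2 m hm
      refine ⟨m', hm', fun N' hN' => ?_⟩
      rcases Finset.mem_insert.1 hN' with rfl | hN'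
      · exact h1
      · exact h2 N'.1 N'.2.1 (hmF N' hN')
  choose m hm hmF using hfin
  let U : Ultrafilter (Finset 𝒩) := Ultrafilter.of atTop
  have hlim : ∀ f, ∃ c, Tendsto (fun F => m F f) U (𝓝 c) := fun f => by
    obtain ⟨c, -, hc⟩ := (isCompact_closedBall (0 : ℂ) (2 * ‖f‖)).ultrafilter_le_nhds'
      (U.map fun F => m F f) (Ultrafilter.mem_map.2 (Filter.univ_mem' fun F =>
        mem_closedBall_zero_iff.2 ((hm F).bound f)))
    exact ⟨c, hc⟩
  choose L hL using hlim
  let M : lp (fun _ : G => ℂ) ∞ →ₗ[ℂ] ℂ :=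
    { toFun := L
      map_add' := fun f g => tendsto_nhds_unique (hL (f + g))
        (((hL f).add (hL g)).congr fun F => (map_add (m F) f g).symm)
      map_smul' := fun c f => tendsto_nhds_unique (hL (c • f))
        (((hL f).const_smul c).congr fun F => (map_smul (m F) c f).symm) }
  have hM : IsMean M := by
    refine ⟨tendsto_nhds_unique (hL 1) (tendsto_const_nhds.congr fun F => (hm F).one.symm),
      fun f hf => ?_⟩
    exact ge_of_tendsto' (hL f) fun F => (hm F).pos f hf
  let H : Subgroup G :=
    { carrier := {t | ∀ f, M (leftTranslate t f) = M f}
      mul_mem' := fun {a b} ha hb f => by rw [leftTranslate_mul, ha, hb]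
      one_mem' := fun f => by rw [leftTranslate_one]
      inv_mem' := fun {a} ha f => by
        rw [← ha (leftTranslate a⁻¹ f), ← leftTranslate_mul, mul_inv_cancel, leftTranslate_one] }
  have hH : amenableRadical G ≤ H := by
    refine sSup_le fun N hN t ht f => ?_
    refine tendsto_nhds_unique (hL (leftTranslate t f)) ((hL f).congr' ?_)
    have : ∀ᶠ F in (U : Filter (Finset 𝒩)), ({⟨N, hN⟩} : Finset 𝒩) ≤ F :=
      Ultrafilter.of_le atTop (eventually_ge_atTop _)
    filter_upwards [this] with F hF
    exact (hmF F ⟨N, hN⟩ (hF (Finset.mem_singleton_self _)) t ht f).symm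
  exact isAmenable_of_invariant_mean _ M hM fun t ht => hH ht

/-! An amenable normal subgroup `N` fixes a regular probability measure `ν` on any boundary `X`, the
push-forward of an invariant mean along an orbit. As `N` is normal, it fixes every translate `g ν`,
hence every weak* limit of translates; strong proximality provides such a limit that is a point
mass, so `N` has a fixed point. The fixed points of `N` form a `G`-invariant closed set, which is
all of `X` by minimality. So a faithful boundary action leaves no room for a nontrivial `N`, and
`∂_F G` is a boundary of `G / N`. It inherits universality, because every boundary of `G / N` is one
of `G`. Equivariant maps into a boundary are unique, which makes universal boundaries isomorphic. -/

open scoped BoundedContinuousFunction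

/-! ### Strongly proximal actions -/

theorem eq_of_forall_mul_apply_le {X : Type*} [TopologicalSpace X] [T35Space X] {a b : X} {r : ℝ}
    (hr : 0 < r) (h : ∀ f : X →ᵇ ℝ, 0 ≤ f → r * f a ≤ f b) : a = b := by
  by_contra hne
  obtain ⟨φ, hφ, hφb, hφa⟩ := CompletelyRegularSpace.completely_regular b {a} isClosed_singleton
    (Ne.symm hne)
  let f : X →ᵇ ℝ := BoundedContinuousFunction.ofNormedAddCommGroup (fun x => (φ x : ℝ))
    (continuous_subtype_val.comp hφ) 1 fun x => by
      rw [Real.norm_of_nonneg (φ x).2.1]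
      exact (φ x).2.2
  have hfb : f b = 0 := congrArg Subtype.val hφb
  have hfa : f a = 1 := congrArg Subtype.val (hφa rfl)
  have hle : r * f a ≤ f b := h f fun x => (φ x).2.1
  rw [hfa, hfb, mul_one] at hle
  exact hle.not_gt hr

theorem integral_half_smul_dirac_add_dirac {X : Type*} [TopologicalSpace X]
    [MeasurableSpace X] [OpensMeasurableSpace X] (f : X →ᵇ ℝ) (y z : X) :
    ∫ x, f x ∂((2⁻¹ : ℝ≥0∞) • (Measure.dirac y + Measure.dirac z)) = 2⁻¹ * (f y + f z) := by
  rw [integral_smul_measure, integral_add_measure (f.integrable _) (f.integrable _),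
    integral_dirac' _ _ f.continuous.stronglyMeasurable,
    integral_dirac' _ _ f.continuous.stronglyMeasurable]
  simp

section StronglyProximal

variable {G : Type u} [Group G] {X : Type v} [TopologicalSpace X] [CompactSpace X]
  {B : Type w} [TopologicalSpace B] [CompactSpace B] [T2Space B] [MulAction G B]
  [ContinuousConstSMul G B]

theorem IsStronglyProximal.exists_tendsto_smul_pair (hB : IsStronglyProximal G B) (y z : B) :
    ∃ (b : B) (F : Ultrafilter G), Tendsto (fun g : G => g • y) F (𝓝 b) ∧
      Tendsto (fun g : G => g • z) F (𝓝 b) := by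
  borelize B
  have hprob : IsProbabilityMeasure ((2⁻¹ : ℝ≥0∞) • (Measure.dirac y + Measure.dirac z)) :=
    ⟨by simp [ENNReal.inv_two_add_inv_two]⟩
  obtain ⟨b, F, hF⟩ := hB.exists_ultrafilter ⟨_, hprob⟩
  have hmid (f : B →ᵇ ℝ) : Tendsto (fun g : G => 2⁻¹ * (f (g • y) + f (g • z))) F (𝓝 (f b)) :=
    (hF f).congr fun g => integral_half_smul_dirac_add_dirac
      (f.compContinuous ⟨_, continuous_const_smul g⟩) y z
  obtain ⟨c, hc⟩ : ∃ c, Tendsto (fun g : G => g • y) F (𝓝 c) :=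
    ⟨_, (F.map fun g => g • y).le_nhds_lim⟩
  obtain ⟨d, hd⟩ : ∃ d, Tendsto (fun g : G => g • z) F (𝓝 d) :=
    ⟨_, (F.map fun g => g • z).le_nhds_lim⟩
  have hcd (f : B →ᵇ ℝ) : 2⁻¹ * (f c + f d) = f b :=
    tendsto_nhds_unique ((((f.continuous.tendsto c).comp hc).add
      ((f.continuous.tendsto d).comp hd)).const_mul _) (hmid f)
  have hcb : c = b := eq_of_forall_mul_apply_le (inv_pos.2 two_pos) fun f hf => by
    linarith [hcd f, show 0 ≤ f d from hf d]
  have hdb : d = b := eq_of_forall_mul_apply_le (inv_pos.2 two_pos) fun f hf => by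
    linarith [hcd f, show 0 ≤ f c from hf c]
  exact ⟨b, F, hcb ▸ hc, hdb ▸ hd⟩

theorem IsStronglyProximal.equivariant_ext [MulAction G X] [MulAction.IsMinimal G X]
    (hB : IsStronglyProximal G B) {f₁ f₂ : X → B} (hf₁ : Continuous f₁) (hf₂ : Continuous f₂)
    (he₁ : ∀ (g : G) (x : X), f₁ (g • x) = g • f₁ x)
    (he₂ : ∀ (g : G) (x : X), f₂ (g • x) = g • f₂ x) : f₁ = f₂ := by
  funext x
  obtain ⟨b, F, h₁, h₂⟩ := hB.exists_tendsto_smul_pair (f₁ x) (f₂ x)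
  obtain ⟨c, hc⟩ : ∃ c, Tendsto (fun g : G => g • x) F (𝓝 c) :=
    ⟨_, (F.map fun g => g • x).le_nhds_lim⟩
  have hc₁ : f₁ c = b := tendsto_nhds_unique ((hf₁.tendsto c).comp hc)
    (h₁.congr fun g => (he₁ g x).symm)
  have hc₂ : f₂ c = b := tendsto_nhds_unique ((hf₂.tendsto c).comp hc)
    (h₂.congr fun g => (he₂ g x).symm)
  have horbit : Set.EqOn f₁ f₂ (MulAction.orbit G c) := by
    rintro _ ⟨g, rfl⟩
    simp only [he₁, he₂, hc₁, hc₂]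
  exact congrFun (hf₁.ext_on (MulAction.dense_orbit G c) hf₂ horbit) x

theorem IsStronglyProximal.nonempty_fixedPoints [MeasurableSpace B] [BorelSpace B]
    (hB : IsStronglyProximal G B) (N : Subgroup G) [N.Normal] (ν : ProbabilityMeasure B)
    [SMulInvariantMeasure N B (ν : Measure B)] : (MulAction.fixedPoints N B).Nonempty := by
  obtain ⟨c, F, hF⟩ := hB.exists_ultrafilter ν
  refine ⟨c, fun n => ?_⟩
  have htranslate (f : B →ᵇ ℝ) (g : G) : ∫ y, f (g • y) ∂(ν : Measure B) =
      ∫ y, f ((n : G) • g • y) ∂(ν : Measure B) := by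
    let k : N := ⟨g⁻¹ * n * g, Subgroup.Normal.conj_mem' ‹N.Normal› n n.2 g⟩
    calc ∫ y, f (g • y) ∂(ν : Measure B)
        = ∫ y, f (g • k • y) ∂(ν : Measure B) :=
          (integral_smul_eq_self (fun y => f (g • y)) (g := k)).symm
      _ = ∫ y, f ((n : G) • g • y) ∂(ν : Measure B) := by
          simp only [k, Subgroup.smul_def, smul_smul, mul_assoc, mul_inv_cancel_left]
  have hval (f : B →ᵇ ℝ) : f ((n : G) • c) = f c := tendsto_nhds_unique
    (hF (f.compContinuous ⟨_, continuous_const_smul (n : G)⟩)) ((hF f).congr (htranslate f))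
  exact eq_of_forall_mul_apply_le one_pos fun f _ => ((one_mul _).trans (hval f)).le

end StronglyProximal

theorem fixedPoints_eq_univ_of_isMinimal {G X : Type*} [Group G] [TopologicalSpace X] [T2Space X]
    [MulAction G X] [ContinuousConstSMul G X] [MulAction.IsMinimal G X] (N : Subgroup G)
    [N.Normal] (hN : (MulAction.fixedPoints N X).Nonempty) :
    MulAction.fixedPoints N X = Set.univ := by
  obtain ⟨c, hc⟩ := hN
  refine Set.eq_univ_of_forall fun x n => ?_
  have horbit : Set.EqOn (fun y => (n : G) • y) id (MulAction.orbit G c) := by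
    rintro _ ⟨g, rfl⟩
    exact smul_mem_fixedPoints_of_normal g hc n
  exact congrFun ((continuous_const_smul (n : G)).ext_on (MulAction.dense_orbit G c)
    continuous_id horbit) x

/-! ### Invariant measures of amenable groups -/

section InvariantMeasure

variable {X : Type v} [TopologicalSpace X] [CompactSpace X]

/-- The map `f ↦ f ∘ p` from `C(X, ℝ)` to `ℓ^∞(S)`. Composing a mean on `ℓ^∞(S)` with it gives a
state on `C(X, ℝ)`, the push-forward of the mean along `p`. -/
noncomputable def continuousMapPullback {S : Type u} (p : S → X) :
    C(X, ℝ) →ₗ[ℝ] lp (fun _ : S => ℂ) ∞ where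
  toFun f := boundedFun (fun s => (f (p s) : ℂ)) ‖f‖ fun s => by
    rw [Complex.norm_real]
    exact f.norm_coe_le_norm (p s)
  map_add' _ _ := lp.ext (funext fun _ => Complex.ofReal_add _ _)
  map_smul' _ _ := lp.ext (funext fun _ => Complex.ofReal_mul _ _)

variable [T2Space X] [MeasurableSpace X] [BorelSpace X]

theorem exists_regular_probabilityMeasure_integral_eq (Λ : C(X, ℝ) →ₗ[ℝ] ℝ)
    (hpos : ∀ f, 0 ≤ f → 0 ≤ Λ f) (hone : Λ 1 = 1) :
    ∃ ν : ProbabilityMeasure X, (ν : Measure X).Regular ∧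
      ∀ f : C(X, ℝ), ∫ x, f x ∂(ν : Measure X) = Λ f := by
  let ι : CompactlySupportedContinuousMap X ℝ →ₗ[ℝ] C(X, ℝ) :=
    { toFun := fun f => f, map_add' := fun _ _ => rfl, map_smul' := fun _ _ => rfl }
  let Λc : CompactlySupportedContinuousMap X ℝ →ₚ[ℝ] ℝ :=
    PositiveLinearMap.mk₀ (Λ ∘ₗ ι) fun f hf => hpos (ι f) hf
  have hint (f : C(X, ℝ)) : ∫ x, f x ∂(RealRMK.rieszMeasure Λc) = Λ f :=
    RealRMK.integral_rieszMeasure Λc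
      (CompactlySupportedContinuousMap.continuousMapEquiv f)
  have huniv : (RealRMK.rieszMeasure Λc).real Set.univ = 1 := by
    simpa only [ContinuousMap.one_apply, integral_const, smul_eq_mul, mul_one, hone] using hint 1
  exact ⟨⟨_, ⟨(ENNReal.toReal_eq_one_iff _).1 huniv⟩⟩,
    inferInstanceAs (RealRMK.rieszMeasure Λc).Regular, hint⟩

theorem IsMean.exists_regular_probabilityMeasure {S : Type u}
    {m : lp (fun _ : S => ℂ) ∞ →ₗ[ℂ] ℂ} (hm : IsMean m) (p : S → X) :
    ∃ ν : ProbabilityMeasure X, (ν : Measure X).Regular ∧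
      ∀ f : C(X, ℝ), ∫ x, f x ∂(ν : Measure X) = (m (continuousMapPullback p f)).re := by
  refine exists_regular_probabilityMeasure_integral_eq
    (Complex.reLm ∘ₗ m.restrictScalars ℝ ∘ₗ continuousMapPullback p) (fun f hf => ?_) ?_
  · exact (Complex.le_def.1 (hm.pos (continuousMapPullback p f) fun s =>
      Complex.zero_le_real.2 (hf (p s)))).1
  · have hone : continuousMapPullback p (1 : C(X, ℝ)) = 1 :=
      lp.ext (funext fun _ => Complex.ofReal_one)
    exact (congrArg (fun a => (m a).re) hone).trans (congrArg Complex.re hm.one)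

theorem IsAmenable.exists_smulInvariantMeasure {H : Type u} [Group H] (hH : IsAmenable H)
    [Nonempty X] [MulAction H X] [ContinuousConstSMul H X] :
    ∃ ν : ProbabilityMeasure X, SMulInvariantMeasure H X (ν : Measure X) := by
  obtain ⟨m, hm, hinv⟩ := (isAmenable_iff H).1 hH
  obtain ⟨x₀⟩ := ‹Nonempty X›
  obtain ⟨ν, hreg, hν⟩ := hm.exists_regular_probabilityMeasure fun s : H => s • x₀
  have hint (h : H) (f : C(X, ℝ)) :
      ∫ x, f (h • x) ∂(ν : Measure X) = ∫ x, f x ∂(ν : Measure X) := by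
    let fh : C(X, ℝ) := f.comp ⟨_, continuous_const_smul h⟩
    have htranslate : continuousMapPullback (fun s : H => s • x₀) fh =
        leftTranslate h⁻¹ (continuousMapPullback (fun s : H => s • x₀) f) := by
      refine lp.ext (funext fun s => ?_)
      change ((f (h • s • x₀) : ℝ) : ℂ) = ((f ((h⁻¹⁻¹ * s) • x₀) : ℝ) : ℂ)
      rw [inv_inv, mul_smul]
    rw [hν f, ← hinv h⁻¹, ← htranslate, ← hν fh]
    rfl
  refine ⟨ν, (smulInvariantMeasure_tfae H (ν : Measure X)).out 5 0 |>.1 fun h => ?_⟩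
  have : ((ν : Measure X).map (h • ·)).Regular := Measure.Regular.map (Homeomorph.smul h)
  refine Measure.ext_of_integral_eq_on_compactlySupported fun f => ?_
  exact (integral_map (continuous_const_smul h).aemeasurable
    f.continuous.measurable.aestronglyMeasurable).trans (hint h f)

end InvariantMeasure

theorem IsBoundary.le_ker_toPermHom_of_isAmenable {G : Type u} {X : Type v} [Group G]
    [TopologicalSpace X] [MulAction G X] (hX : IsBoundary G X) (N : Subgroup G) [N.Normal]
    (hN : IsAmenable N) : N ≤ (MulAction.toPermHom G X).ker := by
  have := hX.nonempty
  have := hX.compactSpace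
  have := hX.t2Space
  have := hX.continuousConstSMul
  have := hX.isMinimal
  have : ContinuousConstSMul N X := ⟨fun n => continuous_const_smul (n : G)⟩
  borelize X
  obtain ⟨ν, _⟩ := hN.exists_smulInvariantMeasure (X := X)
  have hfix : MulAction.fixedPoints N X = Set.univ :=
    fixedPoints_eq_univ_of_isMinimal N (hX.isStronglyProximal.nonempty_fixedPoints N ν)
  exact fun n hn => Equiv.ext fun x => Set.eq_univ_iff_forall.1 hfix x ⟨n, hn⟩

/-! ### Furstenberg boundaries of quotients -/

section Surjective

variable {G : Type u} {H : Type v} [Group G] [Group H] {X : Type w} [TopologicalSpace X]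
  [MulAction G X] [MulAction H X]

theorem continuousConstSMul_iff_of_surjective {π : G → H} (hπ : Function.Surjective π)
    (h : ∀ (g : G) (x : X), π g • x = g • x) :
    ContinuousConstSMul H X ↔ ContinuousConstSMul G X :=
  ⟨fun hX => ⟨fun g => by simpa only [h] using hX.continuous_const_smul (π g)⟩,
    fun hX => ⟨hπ.forall.2 fun g => by simpa only [h] using hX.continuous_const_smul g⟩⟩

theorem isMinimal_iff_of_surjective {π : G → H} (hπ : Function.Surjective π)
    (h : ∀ (g : G) (x : X), π g • x = g • x) :
    MulAction.IsMinimal H X ↔ MulAction.IsMinimal G X := by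
  have horbit (x : X) : MulAction.orbit H x = MulAction.orbit G x := by
    ext y
    simp only [MulAction.mem_orbit_iff, hπ.exists, h]
  exact ⟨fun hX => ⟨fun x => horbit x ▸ hX.dense_orbit x⟩,
    fun hX => ⟨fun x => (horbit x).symm ▸ hX.dense_orbit x⟩⟩

theorem isStronglyProximal_iff_of_surjective {π : G → H} (hπ : Function.Surjective π)
    (h : ∀ (g : G) (x : X), π g • x = g • x) :
    IsStronglyProximal H X ↔ IsStronglyProximal G X := by
  simp only [IsStronglyProximal, hπ.exists, h]

theorem isBoundary_iff_of_surjective {π : G → H} (hπ : Function.Surjective π)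
    (h : ∀ (g : G) (x : X), π g • x = g • x) : IsBoundary H X ↔ IsBoundary G X := by
  have hcont := continuousConstSMul_iff_of_surjective hπ h
  have hmin := isMinimal_iff_of_surjective hπ h
  have hprox := isStronglyProximal_iff_of_surjective hπ h
  exact ⟨fun ⟨⟨hne, hcomp, hT2, hc⟩, hm, hs⟩ =>
      ⟨⟨hne, hcomp, hT2, hcont.1 hc⟩, hmin.1 hm, hprox.1 hs⟩,
    fun ⟨⟨hne, hcomp, hT2, hc⟩, hm, hs⟩ =>
      ⟨⟨hne, hcomp, hT2, hcont.2 hc⟩, hmin.2 hm, hprox.2 hs⟩⟩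

theorem IsFurstenbergBoundary.of_surjective (hX : IsFurstenbergBoundary G X) {π : G →* H}
    (hπ : Function.Surjective π) (h : ∀ (g : G) (x : X), π g • x = g • x) :
    IsFurstenbergBoundary H X := by
  refine ⟨(isBoundary_iff_of_surjective hπ h).2 hX.toIsBoundary, fun B _ _ hB => ?_⟩
  let _ : MulAction G B := MulAction.compHom B π
  obtain ⟨f, hf, hfe, hfs⟩ :=
    hX.exists_map B ((isBoundary_iff_of_surjective hπ fun _ _ => rfl).1 hB)
  exact ⟨f, hf, hπ.forall.2 fun g x => (congrArg f (h g x)).trans (hfe g x), hfs⟩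

end Surjective

theorem IsFurstenbergBoundary.exists_equivariant_homeomorph {G : Type u} [Group G] {X : Type v}
    [TopologicalSpace X] [MulAction G X] {Y : Type w} [TopologicalSpace Y] [MulAction G Y]
    (hX : IsFurstenbergBoundary G X) (hY : IsFurstenbergBoundary G Y) :
    ∃ φ : X ≃ₜ Y, ∀ (g : G) (x : X), φ (g • x) = g • φ x := by
  have ⟨_, _, _, _⟩ := hX.toIsCompactGSpace
  have ⟨_, _, _, _⟩ := hY.toIsCompactGSpace
  have := hX.isMinimal
  have := hY.isMinimal
  obtain ⟨p, hp, hpe, -⟩ := hX.exists_map Y hY.toIsBoundary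
  obtain ⟨q, hq, hqe, -⟩ := hY.exists_map X hX.toIsBoundary
  have hqp : q ∘ p = id := hX.isStronglyProximal.equivariant_ext (hq.comp hp) continuous_id
    (fun g x => (congrArg q (hpe g x)).trans (hqe g (p x))) fun _ _ => rfl
  have hpq : p ∘ q = id := hY.isStronglyProximal.equivariant_ext (hp.comp hq) continuous_id
    (fun g y => (congrArg p (hqe g y)).trans (hpe g (q y))) fun _ _ => rfl
  exact ⟨⟨⟨p, q, congrFun hqp, congrFun hpq⟩, hp, hq⟩, hpe⟩

theorem IsFurstenbergBoundary.exists_homeomorph_quotient {G : Type u} [Group G] {N : Subgroup G}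
    [N.Normal] {X : Type v} [TopologicalSpace X] [MulAction G X] {Y : Type w} [TopologicalSpace Y]
    [MulAction (G ⧸ N) Y] (hX : IsFurstenbergBoundary G X) (hY : IsFurstenbergBoundary (G ⧸ N) Y)
    (hN : N ≤ (MulAction.toPermHom G X).ker) :
    ∃ φ : X ≃ₜ Y, ∀ (g : G) (x : X), φ (g • x) = (QuotientGroup.mk g : G ⧸ N) • φ x := by
  let _ : MulAction (G ⧸ N) X := MulAction.compHom X (QuotientGroup.lift N _ hN)
  have hXN : IsFurstenbergBoundary (G ⧸ N) X :=
    hX.of_surjective (QuotientGroup.mk'_surjective N) fun _ _ => rfl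
  obtain ⟨φ, hφ⟩ := hXN.exists_equivariant_homeomorph hY
  exact ⟨φ, fun g x => hφ (QuotientGroup.mk g) x⟩

theorem IsTopologicallyFree.faithfulSMul {G : Type u} {X : Type v} [Group G] [TopologicalSpace X]
    [MulAction G X] [Nonempty X] (hX : IsTopologicallyFree G X) : FaithfulSMul G X := by
  refine ⟨fun {a b} hab => ?_⟩
  by_contra hne
  obtain ⟨x, hx⟩ := (hX (b⁻¹ * a) fun h => hne (inv_mul_eq_one.1 h).symm).nonempty
  exact hx (by rw [mul_smul, hab, inv_smul_smul])

theorem mainTheorem12_general (G : Type u) [Group G] :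
    (∀ (N : Subgroup G) [N.Normal], IsAmenable N →
      ∀ (X : Type v) [TopologicalSpace X] [MulAction G X]
        (Y : Type w) [TopologicalSpace Y] [MulAction (G ⧸ N) Y],
        IsFurstenbergBoundary G X → IsFurstenbergBoundary (G ⧸ N) Y →
        ∃ φ : X ≃ₜ Y, ∀ (g : G) (x : X), φ (g • x) = (QuotientGroup.mk g : G ⧸ N) • φ x) ∧
    (∀ (X : Type v) [TopologicalSpace X] [MulAction G X],
        IsBoundary G X → FaithfulSMul G X → amenableRadical G = ⊥) := by
  refine ⟨fun N _ hN X _ _ Y _ _ hX hY => hX.exists_homeomorph_quotient hY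
    (hX.toIsBoundary.le_ker_toPermHom_of_isAmenable N hN), fun X _ _ hX _ => ?_⟩
  have hker : (MulAction.toPermHom G X).ker = ⊥ :=
    (MonoidHom.ker_eq_bot_iff _).2 MulAction.toPerm_injective
  exact le_bot_iff.1 (hker ▸ hX.le_ker_toPermHom_of_isAmenable _
    (isGreatest_amenableRadical G).1.2)

theorem mainTheorem12 (G : Type u) [Group G] :
    (∀ (X : Type v) [TopologicalSpace X] [MulAction G X]
        (Y : Type w) [TopologicalSpace Y] [MulAction (G ⧸ amenableRadical G) Y],
        IsFurstenbergBoundary G X →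
        IsFurstenbergBoundary (G ⧸ amenableRadical G) Y →
        ∃ φ : X ≃ₜ Y, ∀ (g : G) (x : X),
          φ (g • x) = (QuotientGroup.mk g : G ⧸ amenableRadical G) • φ x) ∧
    (∀ (X : Type v) [TopologicalSpace X] [MulAction G X],
        IsFurstenbergBoundary G X → IsTopologicallyFree G X → amenableRadical G = ⊥) :=
  ⟨(mainTheorem12_general.{u, v, w} G).1 _ (isGreatest_amenableRadical G).1.2,
    fun X _ _ hX hfree => have := hX.nonempty
      (mainTheorem12_general.{u, v, w} G).2 X hX.toIsBoundary hfree.faithfulSMul⟩
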